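/- Let $(\mathcal S,\mathcal A,P,r,\gamma,\rho)$ be a Markov decision process with measurable state space $\mathcal S$, finite non-empty action space $\mathcal A$, measurable reward $r:\mathcal S\times\mathcal A\to\mathbb R$ and discount factor $\gamma\in[0,1)$, and let $T$ be the (fixed, finite) episode length. (If $\gamma=0$, put $\gamma^{-1}:=0$ below.) Let $\mathcal H_K$ be a real reproducing kernel Hilbert space of functions on $\mathcal S\times\mathcal A$ with kernel $K$, such that $s\mapsto K((s,a),\cdot)\in\mathcal H_K$ is strongly measurable for each $a\in\mathcal A$. Let $\mathcal T\in\mathbb R$ be the temperature, and for $h\in\mathcal H_K$ let $$\pi_h(a\mid s)=\frac{e^{\mathcal T h(s,a)}}{\sum_{a'\in\mathcal A}e^{\mathcal T h(s,a')}}$$ be the softmax policy. Let $p(\tau;\pi_h)$ be the law of the trajectory $\tau=(s_0,a_0,\dots,a_{T-1},s_T)$ with $s_0\sim\rho$, $a_t\sim\pi_h(\cdot\mid s_t)$, $s_{t+1}\sim P(\cdot\mid s_t,a_t)$, and put $$J(\pi_h)=\mathbb E_{\tau\sim p(\tau;\pi_h)}\Big[\sum_{t=0}^{T-1}\gamma^{t-1}r(s_t,a_t)\Big],\qquad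 \Psi_t(\tau)=\sum_{i=t}^{T-1}\gamma^{i-1}r(s_i,a_i).$$ Assume the moment conditions $\mathbb E_{\tau\sim p(\tau;\pi_0)}\big[|r(s_i,a_i)|\big]<\infty$ and $\mathbb E_{\tau\sim p(\tau;\pi_0)}\big[|r(s_i,a_i)|\,K((s_t,a),(s_t,a))\big]<\infty$ for all $0\le i,t<T$ and $a\in\mathcal A$, where $\pi_0$ is the uniform policy (equivalently, the same under every $\pi_h$; they hold for example if $r$ and $K$ are bounded). For $u,v\in\mathcal H_K$ let $u\otimes v$ denote the outer product in the Hilbert space tensor product $\mathcal H_K\otimes\mathcal H_K$; elements of $\mathcal H_K\otimes\mathcal H_K$ act on $\mathcal H_K$ as Hilbert–Schmidt operators, through $(u\otimes v)\circ w=\langle v,w\rangle u$. Then $h\mapsto\log\pi_h(a\mid s)$ is Fréchet differentiable on $\mathcal H_K$ for all $s,a$, with gradient $\nabla_h\log\pi_h(a\mid s)\in\mathcal H_K$; the return $\sum_{t}\gamma^{t-1}r(s_t,a_t)$ is $p(\tau;\pi_h)$-integrable for every $h$; $h\mapsto J(\pi_h)$ is Fréchet differentiable, with gradient $\nabla_hJ(\pi_h)\in\mathcal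 H_K$; and the map $h\mapsto\nabla_hJ(\pi_h)$ is Fréchet differentiable at every $h\in\mathcal H_K$, its derivative being the operator $$\nabla_h^2J(\pi_h)=\mathbb E_{\tau\sim p(\tau;\pi_h)}\big[H_h(\tau;\pi_h)\big]\in\mathcal H_K\otimes\mathcal H_K,$$ where $H_h(\tau;\pi_h)$ is Bochner integrable in $\mathcal H_K\otimes\mathcal H_K$ and $$H_h(\tau;\pi_h)=\Big(\sum_{t=0}^{T-1}\Psi_t(\tau)\nabla_h\log\pi_h(a_t\mid s_t)\Big)\otimes\Big(\sum_{t'=0}^{T-1}\nabla_h\log\pi_h(a_{t'}\mid s_{t'})\Big)-\mathcal T^2\sum_{t=0}^{T-1}\Psi_t(\tau)\,\mathrm{Cov}_{a'\sim\pi_h(\cdot\mid s_t)}\big[K((s_t,a'),\cdot)\big],$$ with the covariance operator $$\mathrm{Cov}_{a'\sim\pi_h(\cdot\mid s)}\big[K((s,a'),\cdot)\big]=\mathbb E_{a'\sim\pi_h(\cdot\mid s)}\big[K((s,a'),\cdot)\otimes K((s,a'),\cdot)\big]-\mathbb E_{a'\sim\pi_h(\cdot\mid s)}\big[K((s,a'),\cdot)\big]\otimes\mathbb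 E_{a''\sim\pi_h(\cdot\mid s)}\big[K((s,a''),\cdot)\big].$$ -/

import Mathlib

open MeasureTheory ProbabilityTheory
open scoped TensorProduct Gradient

namespace PolicyNewton

/-! ### Hilbert tensor square and its action on the space -/

/-- The Hilbert space tensor product `H ⊗ H`: the completion of the algebraic tensor product for
the inner product `⟪u ⊗ v, u' ⊗ v'⟫ = ⟪u, u'⟫ ⟪v, v'⟫`. -/
abbrev HTensor (H : Type*) [NormedAddCommGroup H] [InnerProductSpace ℝ H] : Type _ :=
  UniformSpace.Completion (H ⊗[ℝ] H)

section Tensor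

variable {H : Type*} [NormedAddCommGroup H] [InnerProductSpace ℝ H]

/-- The outer product `u ⊗ v` as an element of the Hilbert space `H ⊗ H`. -/
noncomputable def outer (u v : H) : HTensor H := ((u ⊗ₜ[ℝ] v : H ⊗[ℝ] H) : HTensor H)

theorem inner_outer (u v u' v' : H) :
    inner ℝ (outer u v) (outer u' v') = inner ℝ u u' * inner ℝ v v' := by
  simp [outer]

theorem norm_outer (u v : H) : ‖outer u v‖ = ‖u‖ * ‖v‖ := by
  simp [outer]

/-- The bounded bilinear form `(w, u) ↦ ⟪X, u ⊗ w⟫` of an element `X` of `H ⊗ H`. -/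
noncomputable def tensorForm (X : HTensor H) : H →L⋆[ℝ] H →L[ℝ] ℝ :=
  LinearMap.mkContinuous₂
    (LinearMap.mk₂'ₛₗ (starRingEnd ℝ) (RingHom.id ℝ)
      (fun w u : H => inner ℝ X (outer u w))
      (fun w w' u => by
        simp [outer, TensorProduct.tmul_add, UniformSpace.Completion.coe_add, inner_add_right])
      (fun c w u => by
        simp [outer, TensorProduct.tmul_smul, UniformSpace.Completion.coe_smul,
          inner_smul_right])
      (fun w u u' => by
        simp [outer, TensorProduct.add_tmul, UniformSpace.Completion.coe_add, inner_add_right])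
      (fun c w u => by
        simp [outer, ← TensorProduct.smul_tmul', UniformSpace.Completion.coe_smul,
          inner_smul_right]))
    ‖X‖
    (fun w u => by
      refine (norm_inner_le_norm X (outer u w)).trans (le_of_eq ?_)
      rw [norm_outer]; ring)

/-- The (Hilbert–Schmidt) operator `w ↦ X ∘ w` on `H` given by an element `X` of `H ⊗ H`, i.e.
the operator with `⟪X ∘ w, u⟫ = ⟪X, u ⊗ w⟫`; on outer products `(u ⊗ v) ∘ w = ⟪v, w⟫ u`. -/
noncomputable def tensorOp [CompleteSpace H] (X : HTensor H) : H →L[ℝ] H :=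
  InnerProductSpace.continuousLinearMapOfBilin (tensorForm X)

theorem inner_tensorOp [CompleteSpace H] (X : HTensor H) (w u : H) :
    inner ℝ (tensorOp X w) u = inner ℝ X (outer u w) := by
  rw [tensorOp, InnerProductSpace.continuousLinearMapOfBilin_apply]
  rfl

theorem tensorOp_outer [CompleteSpace H] (u v w : H) :
    tensorOp (outer u v) w = (inner ℝ v w : ℝ) • u := by
  refine ext_inner_right ℝ fun z => ?_
  rw [inner_tensorOp, inner_outer, real_inner_smul_left, mul_comm]

end Tensor

/-! ### Markov decision processes and softmax policies -/

/-- A Markov decision process `(S, A, P, r, γ, ρ)`. -/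
structure MDP (S A : Type*) [MeasurableSpace S] [MeasurableSpace A] where
  /-- transition probabilities `P(· ∣ s, a)` -/
  P : Kernel (S × A) S
  markov_P : IsMarkovKernel P
  /-- reward function -/
  r : S × A → ℝ
  measurable_r : Measurable r
  /-- discount factor -/
  γ : ℝ
  γ_nonneg : 0 ≤ γ
  γ_lt_one : γ < 1
  /-- initial state distribution -/
  ρ : Measure S
  prob_ρ : IsProbabilityMeasure ρ

/-- Trajectories `τ = (s₀, a₀, …, a_{n-1}, s_n)`: the states and the actions. -/
abbrev Traj (S A : Type*) (n : ℕ) : Type _ := (Fin (n + 1) → S) × (Fin n → A)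

/-- The law `p(τ; π)` of the trajectory of length `n`: `s₀ ∼ ρ`, `a_t ∼ π(· ∣ s_t)`,
`s_{t+1} ∼ P(· ∣ s_t, a_t)`. -/
noncomputable def trajLaw {S A : Type*} [MeasurableSpace S] [MeasurableSpace A]
    (M : MDP S A) (π : Kernel S A) : (n : ℕ) → Measure (Traj S A n)
  | 0 => M.ρ.map fun s => (fun _ => s, Fin.elim0)
  | n + 1 =>
    (trajLaw M π n ⊗ₘ
      (π ⊗ₖ M.P).comap (fun τ : Traj S A n => τ.1 (Fin.last n)) (by fun_prop)).map
      fun p => (Fin.snoc p.1.1 p.2.2, Fin.snoc p.1.2 p.2.1)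

theorem measurable_snoc (X : Type*) [MeasurableSpace X] (m : ℕ) :
    Measurable fun p : (Fin m → X) × X => (Fin.snoc p.1 p.2 : Fin (m + 1) → X) := by
  refine measurable_pi_lambda _ fun i => ?_
  refine Fin.lastCases ?_ (fun j => ?_) i
  · simpa using measurable_snd
  · simp only [Fin.snoc_castSucc]
    exact (measurable_pi_apply j).comp measurable_fst

theorem isProbabilityMeasure_trajLaw {S A : Type*} [MeasurableSpace S] [MeasurableSpace A]
    (M : MDP S A) (π : Kernel S A) [IsMarkovKernel π] (n : ℕ) :
    IsProbabilityMeasure (trajLaw M π n) := by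
  have := M.markov_P
  have := M.prob_ρ
  induction n with
  | zero =>
    refine Measure.isProbabilityMeasure_map (Measurable.aemeasurable ?_)
    exact (measurable_pi_lambda _ fun _ => measurable_id).prodMk measurable_const
  | succ n ih =>
    refine Measure.isProbabilityMeasure_map (Measurable.aemeasurable ?_)
    have h1 := (measurable_snoc S (n + 1)).comp
      (g := fun p : (Fin (n + 1) → S) × S => (Fin.snoc p.1 p.2 : Fin (n + 2) → S))
      (f := fun p : Traj S A n × (A × S) => (p.1.1, p.2.2)) (by fun_prop)
    have h2 := (measurable_snoc A n).comp
      (g := fun p : (Fin n → A) × A => (Fin.snoc p.1 p.2 : Fin (n + 1) → A))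
      (f := fun p : Traj S A n × (A × S) => (p.1.2, p.2.1)) (by fun_prop)
    exact h1.prodMk h2

/-- The discounted reward to go
`Ψ_t(τ) = ∑_{i=t}^{T-1} γ^{i-1} r(s_i, a_i)` of a trajectory of length `T`. -/
noncomputable def rewardToGo {S A : Type*} [MeasurableSpace S] [MeasurableSpace A]
    (M : MDP S A) {T : ℕ} (t : Fin T) (τ : Traj S A T) : ℝ :=
  ∑ i ∈ Finset.univ.filter (fun i : Fin T => t ≤ i),
    M.γ ^ ((i : ℤ) - 1) * M.r (τ.1 i.castSucc, τ.2 i)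

section Policy

variable {S A : Type*} {H : Type*} [NormedAddCommGroup H] [InnerProductSpace ℝ H]
  [RKHS ℝ H (S × A) ℝ]

/-- The kernel section `K(x, ·) ∈ H` of a real-valued reproducing kernel Hilbert space. -/
noncomputable def kerSec (H : Type*) [NormedAddCommGroup H] [InnerProductSpace ℝ H]
    [RKHS ℝ H (S × A) ℝ] [CompleteSpace H] (x : S × A) : H :=
  RKHS.kerFun H x (1 : ℝ)

/-- The softmax policy `π_h(a ∣ s) = exp (𝒯 h(s, a)) / ∑_{a'} exp (𝒯 h(s, a'))` with
temperature `𝒯`. -/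
noncomputable def softmax [Fintype A] (𝒯 : ℝ) (h : H) (s : S) (a : A) : ℝ :=
  Real.exp (𝒯 * h (s, a)) / ∑ a' : A, Real.exp (𝒯 * h (s, a'))

theorem eval_eq_inner [CompleteSpace H] (h : H) (x : S × A) :
    h x = inner ℝ h (kerSec H x) := by
  simp [kerSec]

theorem measurable_softmax [Fintype A] [MeasurableSpace S] [CompleteSpace H]
    (hK : ∀ a : A, StronglyMeasurable fun s : S => kerSec H (s, a)) (𝒯 : ℝ) (h : H) (a : A) :
    Measurable fun s : S => softmax 𝒯 h s a := by
  have hm : ∀ a : A, Measurable fun s : S => h (s, a) := fun a => by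
    simp_rw [eval_eq_inner]
    exact (stronglyMeasurable_const.inner (hK a)).measurable
  unfold softmax
  exact (((hm a).const_mul 𝒯).exp).div
    (Finset.measurable_sum _ fun a' _ => ((hm a').const_mul 𝒯).exp)

/-- The softmax policy as a kernel from states to actions. -/
noncomputable def policy [Fintype A] [MeasurableSpace S] [MeasurableSpace A] [CompleteSpace H]
    (hK : ∀ a : A, StronglyMeasurable fun s : S => kerSec H (s, a)) (𝒯 : ℝ) (h : H) :
    Kernel S A where
  toFun s := ∑ a : A, ENNReal.ofReal (softmax 𝒯 h s a) • Measure.dirac a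
  measurable' := by
    refine Measure.measurable_of_measurable_coe _ fun B _ => ?_
    simp only [Measure.coe_finsetSum, Finset.sum_apply, Measure.smul_apply, smul_eq_mul]
    exact Finset.measurable_sum _ fun a _ =>
      ((measurable_softmax hK 𝒯 h a).ennreal_ofReal).mul_const _

theorem isMarkovKernel_policy [Fintype A] [Nonempty A] [MeasurableSpace S] [MeasurableSpace A]
    [CompleteSpace H] (hK : ∀ a : A, StronglyMeasurable fun s : S => kerSec H (s, a))
    (𝒯 : ℝ) (h : H) : IsMarkovKernel (policy hK 𝒯 h) := by
  refine ⟨fun s => ⟨?_⟩⟩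
  have hZ : 0 < ∑ a' : A, Real.exp (𝒯 * h (s, a')) :=
    Finset.sum_pos (fun _ _ => Real.exp_pos _) Finset.univ_nonempty
  change (∑ a : A, ENNReal.ofReal (softmax 𝒯 h s a) • Measure.dirac a) Set.univ = 1
  simp only [Measure.coe_finsetSum, Finset.sum_apply, Measure.smul_apply, smul_eq_mul,
    measure_univ, mul_one]
  unfold softmax
  rw [← ENNReal.ofReal_sum_of_nonneg fun a _ => div_nonneg (Real.exp_pos _).le hZ.le,
    ← Finset.sum_div, div_self hZ.ne', ENNReal.ofReal_one]

/-- The expected return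
`J(π_h) = 𝔼_{τ ∼ p(τ; π_h)} [∑_{t=0}^{T-1} γ^{t-1} r(s_t, a_t)]`. -/
noncomputable def expReturn [Fintype A] [MeasurableSpace S] [MeasurableSpace A] [CompleteSpace H]
    (M : MDP S A) (T : ℕ) (hK : ∀ a : A, StronglyMeasurable fun s : S => kerSec H (s, a))
    (𝒯 : ℝ) (h : H) : ℝ :=
  ∫ τ, ∑ t : Fin T, M.γ ^ ((t : ℤ) - 1) * M.r (τ.1 t.castSucc, τ.2 t)
    ∂(trajLaw M (policy hK 𝒯 h) T)

/-- The score `∇_h log π_h(a ∣ s) ∈ H`, a Fréchet gradient. -/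
noncomputable def score [Fintype A] [CompleteSpace H] (𝒯 : ℝ) (h : H) (s : S) (a : A) : H :=
  ∇ (fun h' : H => Real.log (softmax 𝒯 h' s a)) h

/-- The covariance operator `Cov_{a' ∼ π_h(· ∣ s)} [K((s, a'), ·)] ∈ H ⊗ H`. -/
noncomputable def covOp [Fintype A] [CompleteSpace H] (𝒯 : ℝ) (h : H) (s : S) : HTensor H :=
  (∑ a : A, softmax 𝒯 h s a • outer (kerSec H (s, a)) (kerSec H (s, a))) -
    outer (∑ a : A, softmax 𝒯 h s a • kerSec H (s, a))
      (∑ a : A, softmax 𝒯 h s a • kerSec H (s, a))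

/-- The Hessian integrand `H_h(τ; π_h) ∈ H ⊗ H` of a trajectory. -/
noncomputable def hessIntegrand [Fintype A] [MeasurableSpace S] [MeasurableSpace A]
    [CompleteSpace H] (M : MDP S A) {T : ℕ} (𝒯 : ℝ) (h : H) (τ : Traj S A T) : HTensor H :=
  outer (∑ t : Fin T, rewardToGo M t τ • score 𝒯 h (τ.1 t.castSucc) (τ.2 t))
      (∑ t : Fin T, score 𝒯 h (τ.1 t.castSucc) (τ.2 t)) -
    ∑ t : Fin T, (rewardToGo M t τ * 𝒯 ^ 2) • covOp 𝒯 h (τ.1 t.castSucc)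

end Policy

end PolicyNewton

open PolicyNewton

/-! The initial law and the transitions do not depend on h, so relative to the law of the uniform
policy the law of π_h has the explicit density w_h(τ) = ∏ |A| π_h(a_t ∣ s_t)
(`trajLaw_eq_withDensity`). Hence J(π_h) = 𝔼_0[w_h R], where R is the return and 𝔼_0 is free of h,
and derivatives can be taken under the integral. The logarithmic gradient of w_h is the total score
S = ∑ ∇ log π_h(a_t ∣ s_t). The derivative of each score is -𝒯² Cov, whatever the action, so the
second derivative of w_h is w_h (S ⊗ S - 𝒯² ∑ Cov). Domination is uniform in h: w_h ≤ |A|^T, and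
scores and covariances are bounded through norms of kernel sections, which do not involve h. The
moment conditions make these bounds integrable.

The Hessian is thus 𝔼_h[R (S ⊗ S - 𝒯² ∑ Cov)], and it remains to trade R for the rewards to go
(`integral_return_smul_weightHess_sub_hessIntegrand`). This is an induction on the horizon, applied
to the difference of the two integrands. The reward of an added step cancels from that difference.
What is added is linear in the new score, or a multiple of score ⊗ score - 𝒯² Cov, with coefficients
fixed by the past. Given the past, both average to zero over the new action
(`sum_softmax_smul_score`, `sum_softmax_smul_outer_score`).

The passage from H ⊗ H to operators is the bounded linear map `tensorOpL`, so it commutes with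
expectations. -/

namespace PolicyNewton

/-! ### Bounded (bi)linear maps attached to the Hilbert tensor square. -/

section TensorCalculus

variable {H : Type*} [NormedAddCommGroup H] [InnerProductSpace ℝ H]

/-- The outer product as a bounded bilinear map. -/
noncomputable def outerL (H : Type*) [NormedAddCommGroup H] [InnerProductSpace ℝ H] :
    H →L[ℝ] H →L[ℝ] HTensor H :=
  LinearMap.mkContinuous₂
    (LinearMap.mk₂ ℝ outer
      (fun u u' v => by simp [outer, TensorProduct.add_tmul, UniformSpace.Completion.coe_add])
      (fun c u v => by simp [outer, ← TensorProduct.smul_tmul', UniformSpace.Completion.coe_smul])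
      (fun u v v' => by simp [outer, TensorProduct.tmul_add, UniformSpace.Completion.coe_add])
      (fun c u v => by simp [outer, TensorProduct.tmul_smul, UniformSpace.Completion.coe_smul]))
    1 (fun u v => by rw [one_mul]; exact (norm_outer u v).le)

theorem outerL_apply (u v : H) : outerL H u v = outer u v := rfl

theorem stronglyMeasurable_outer {X : Type*} [MeasurableSpace X] {f g : X → H}
    (hf : StronglyMeasurable f) (hg : StronglyMeasurable g) :
    StronglyMeasurable fun x => outer (f x) (g x) := by
  have h : Continuous fun p : H × H => outerL H p.1 p.2 := by fun_prop
  exact h.comp_stronglyMeasurable (hf.prodMk hg)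

variable [CompleteSpace H]

/-- Testing X ∘ w against itself gives ‖X ∘ w‖² = ⟪X, (X ∘ w) ⊗ w⟫ ≤ ‖X‖ ‖X ∘ w‖ ‖w‖, and one factor
cancels. -/
theorem norm_tensorOp_le (X : HTensor H) : ‖tensorOp X‖ ≤ ‖X‖ := by
  refine ContinuousLinearMap.opNorm_le_bound _ (norm_nonneg _) fun w => ?_
  by_cases h0 : ‖tensorOp X w‖ = 0
  · rw [h0]; positivity
  refine le_of_mul_le_mul_right ?_ (lt_of_le_of_ne (norm_nonneg _) (Ne.symm h0))
  rw [← real_inner_self_eq_norm_mul_norm, inner_tensorOp]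
  refine (real_inner_le_norm _ _).trans (le_of_eq ?_)
  rw [norm_outer]; ring

/-- The action of `H ⊗ H` on `H` as a bounded linear map into the bounded operators. -/
noncomputable def tensorOpL (H : Type*) [NormedAddCommGroup H] [InnerProductSpace ℝ H]
    [CompleteSpace H] : HTensor H →L[ℝ] H →L[ℝ] H :=
  LinearMap.mkContinuous
    { toFun := tensorOp
      map_add' := fun X Y => by
        ext w
        refine ext_inner_right ℝ fun z => ?_
        simp [inner_tensorOp, inner_add_left]
      map_smul' := fun c X => by
        ext w
        refine ext_inner_right ℝ fun z => ?_
        simp [inner_tensorOp, real_inner_smul_left] }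
    1 (fun X => by simpa using norm_tensorOp_le X)

theorem tensorOpL_apply (X : HTensor H) : tensorOpL H X = tensorOp X := rfl

end TensorCalculus

/-! ### Softmax calculus at a single state: score, covariance, bounds uniform in h. -/

section Softmax

variable {S A H : Type*} [Fintype A] [Nonempty A] [NormedAddCommGroup H] [InnerProductSpace ℝ H]
  [CompleteSpace H] [RKHS ℝ H (S × A) ℝ]

omit [CompleteSpace H] in
theorem softmax_pos (𝒯 : ℝ) (h : H) (s : S) (a : A) : 0 < softmax 𝒯 h s a :=
  div_pos (Real.exp_pos _) (Finset.sum_pos (fun _ _ => Real.exp_pos _) Finset.univ_nonempty)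

omit [CompleteSpace H] in
theorem sum_softmax (𝒯 : ℝ) (h : H) (s : S) : ∑ a : A, softmax 𝒯 h s a = 1 := by
  have hZ : 0 < ∑ a' : A, Real.exp (𝒯 * h (s, a')) :=
    Finset.sum_pos (fun _ _ => Real.exp_pos _) Finset.univ_nonempty
  simp only [softmax]
  rw [← Finset.sum_div, div_self hZ.ne']

omit [CompleteSpace H] in
theorem softmax_le_one (𝒯 : ℝ) (h : H) (s : S) (a : A) : softmax 𝒯 h s a ≤ 1 := by
  rw [← sum_softmax 𝒯 h s]
  exact Finset.single_le_sum (f := fun a => softmax 𝒯 h s a)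
    (fun a _ => (softmax_pos 𝒯 h s a).le) (Finset.mem_univ a)

omit [Nonempty A] in
theorem softmax_zero (𝒯 : ℝ) (s : S) (a : A) :
    softmax 𝒯 (0 : H) s a = (Fintype.card A : ℝ)⁻¹ := by
  simp [softmax, eval_eq_inner]

/-- The policy mean `𝔼_{a ∼ π_h(· ∣ s)} [K((s, a), ·)]`. -/
noncomputable def meanKer (𝒯 : ℝ) (h : H) (s : S) : H :=
  ∑ a : A, softmax 𝒯 h s a • kerSec H (s, a)

omit [Fintype A] [Nonempty A] in
theorem hasFDerivAt_eval (h : H) (x : S × A) :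
    HasFDerivAt (fun h : H => h x) (innerSL ℝ (kerSec H x)) h := by
  have : (fun h : H => h x) = innerSL ℝ (kerSec H x) := by
    ext h
    rw [eval_eq_inner, real_inner_comm]; rfl
  rw [this]
  exact ContinuousLinearMap.hasFDerivAt _

/-- By the reproducing property 𝒯 h(s, a) has gradient 𝒯 K((s, a), ·), and the log-partition
function has as gradient the policy average of these. -/
theorem hasFDerivAt_log_softmax (𝒯 : ℝ) (h : H) (s : S) (a : A) :
    HasFDerivAt (fun h : H => Real.log (softmax 𝒯 h s a))
      (innerSL ℝ (𝒯 • (kerSec H (s, a) - meanKer 𝒯 h s))) h := by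
  have hpos : ∀ h : H, 0 < ∑ a' : A, Real.exp (𝒯 * h (s, a')) := fun h =>
    Finset.sum_pos (fun _ _ => Real.exp_pos _) Finset.univ_nonempty
  have heq : (fun h : H => Real.log (softmax 𝒯 h s a)) =
      fun h => 𝒯 * h (s, a) - Real.log (∑ a' : A, Real.exp (𝒯 * h (s, a'))) := by
    ext h
    rw [softmax, Real.log_div (Real.exp_pos _).ne' (hpos h).ne', Real.log_exp]
  rw [heq]
  have h1 : ∀ a : A, HasFDerivAt (fun h : H => 𝒯 * h (s, a)) (𝒯 • innerSL ℝ (kerSec H (s, a))) h :=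
    fun a => (hasFDerivAt_eval h (s, a)).const_mul 𝒯
  have h2 := (HasFDerivAt.fun_sum (u := Finset.univ) fun a' _ => (h1 a').exp).log (hpos h).ne'
  refine ((h1 a).sub h2).congr_fderiv ?_
  ext v
  simp [meanKer, softmax, Finset.mul_sum, mul_sub]
  refine Finset.sum_congr rfl fun a' _ => ?_
  ring

theorem score_eq (𝒯 : ℝ) (h : H) (s : S) (a : A) :
    score 𝒯 h s a = 𝒯 • (kerSec H (s, a) - meanKer 𝒯 h s) := by
  refine HasGradientAt.gradient ?_
  rw [hasGradientAt_iff_hasFDerivAt]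
  exact hasFDerivAt_log_softmax 𝒯 h s a

theorem hasFDerivAt_softmax (𝒯 : ℝ) (h : H) (s : S) (a : A) :
    HasFDerivAt (fun h : H => softmax 𝒯 h s a)
      (softmax 𝒯 h s a • innerSL ℝ (score 𝒯 h s a)) h := by
  have := (hasFDerivAt_log_softmax 𝒯 h s a).exp
  simp only [Real.exp_log (softmax_pos 𝒯 _ s a)] at this
  rwa [score_eq]

theorem sum_softmax_smul_score (𝒯 : ℝ) (h : H) (s : S) :
    ∑ a : A, softmax 𝒯 h s a • score 𝒯 h s a = 0 := by
  simp only [score_eq, smul_comm _ 𝒯, ← Finset.smul_sum, smul_sub, Finset.sum_sub_distrib,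
    ← Finset.sum_smul, sum_softmax, one_smul]
  simp [meanKer]

/-- The score is 𝒯 times the centred kernel section, so its second moment is 𝒯² times the
covariance. -/
theorem sum_softmax_smul_outer_score (𝒯 : ℝ) (h : H) (s : S) :
    ∑ a : A, softmax 𝒯 h s a • outer (score 𝒯 h s a) (score 𝒯 h s a) =
      𝒯 ^ 2 • covOp 𝒯 h s := by
  have h1 : ∀ a : A, softmax 𝒯 h s a • outer (score 𝒯 h s a) (score 𝒯 h s a) =
      𝒯 ^ 2 • (softmax 𝒯 h s a • outer (kerSec H (s, a)) (kerSec H (s, a))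
        - outerL H (meanKer 𝒯 h s) (softmax 𝒯 h s a • kerSec H (s, a))
        - outerL H (softmax 𝒯 h s a • kerSec H (s, a)) (meanKer 𝒯 h s)
        + softmax 𝒯 h s a • outerL H (meanKer 𝒯 h s) (meanKer 𝒯 h s)) := fun a => by
    simp only [score_eq, ← outerL_apply, map_smul, map_sub, smul_apply,
      sub_apply]
    module
  have hm : ∑ a : A, softmax 𝒯 h s a • kerSec H (s, a) = meanKer 𝒯 h s := rfl
  have h2 : ∑ a : A, outerL H (softmax 𝒯 h s a • kerSec H (s, a)) (meanKer 𝒯 h s) =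
      outerL H (meanKer 𝒯 h s) (meanKer 𝒯 h s) := by
    rw [← sum_apply, ← map_sum, hm]
  simp_rw [h1]
  rw [← Finset.smul_sum, Finset.sum_add_distrib, Finset.sum_sub_distrib, Finset.sum_sub_distrib,
    h2, ← map_sum, hm, ← Finset.sum_smul, sum_softmax, one_smul, covOp, hm, outerL_apply]
  congr 1
  abel

/-- Only the policy mean varies with h, so the derivative does not see the action. It is -𝒯 ∑ π K ⊗
score. As scores have mean zero, K may be centred here, which turns the sum into -∑ π score ⊗ score.
-/
theorem hasFDerivAt_score (𝒯 : ℝ) (h : H) (s : S) (a : A) :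
    HasFDerivAt (fun h : H => score 𝒯 h s a) (-(tensorOpL H (𝒯 ^ 2 • covOp 𝒯 h s))) h := by
  have h1 : HasFDerivAt (fun h : H => meanKer 𝒯 h s)
      (∑ a : A, (softmax 𝒯 h s a • innerSL ℝ (score 𝒯 h s a)).smulRight (kerSec H (s, a))) h :=
    HasFDerivAt.fun_sum fun a _ => (hasFDerivAt_softmax 𝒯 h s a).smul_const _
  have h2 := (h1.const_sub (kerSec H (s, a))).const_smul 𝒯
  have h0 : (fun h : H => score 𝒯 h s a) = fun h => 𝒯 • (kerSec H (s, a) - meanKer 𝒯 h s) :=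
    funext fun h => score_eq 𝒯 h s a
  rw [h0]
  refine h2.congr_fderiv ?_
  have h3 : ∑ a : A, softmax 𝒯 h s a • outer (meanKer 𝒯 h s) (score 𝒯 h s a) = 0 := by
    simp_rw [← outerL_apply, ← map_smul, ← map_sum, sum_softmax_smul_score, map_zero]
  have h4 : 𝒯 ^ 2 • covOp 𝒯 h s =
      𝒯 • ∑ a : A, softmax 𝒯 h s a • outer (kerSec H (s, a)) (score 𝒯 h s a) := by
    rw [← sum_softmax_smul_outer_score, ← sub_zero (∑ a : A, _ • outer (kerSec H (s, a)) _), ← h3,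
      ← Finset.sum_sub_distrib, Finset.smul_sum]
    refine Finset.sum_congr rfl fun a _ => ?_
    have h5 : outer (score 𝒯 h s a) (score 𝒯 h s a) =
        𝒯 • (outer (kerSec H (s, a)) (score 𝒯 h s a) - outer (meanKer 𝒯 h s) (score 𝒯 h s a)) := by
      simp only [← outerL_apply]
      rw [← sub_apply, ← map_sub, ← smul_apply, ← map_smul, ← score_eq]
    rw [h5]
    module
  rw [h4]
  ext v
  simp [tensorOpL_apply, tensorOp_outer, smul_smul]

/-- The total norm `∑_a ‖K((s, a), ·)‖` of the kernel sections at a state. -/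
noncomputable def kerNorm (H : Type*) [NormedAddCommGroup H] [InnerProductSpace ℝ H]
    [CompleteSpace H] [RKHS ℝ H (S × A) ℝ] (s : S) : ℝ :=
  ∑ a : A, ‖kerSec H (s, a)‖

omit [Nonempty A] in
theorem kerNorm_nonneg (s : S) : 0 ≤ kerNorm (A := A) H s :=
  Finset.sum_nonneg fun _ _ => norm_nonneg _

omit [Nonempty A] in
theorem norm_kerSec_le (s : S) (a : A) : ‖kerSec H (s, a)‖ ≤ kerNorm (A := A) H s :=
  Finset.single_le_sum (f := fun a => ‖kerSec H (s, a)‖) (fun _ _ => norm_nonneg _)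
    (Finset.mem_univ a)

omit [CompleteSpace H] in
theorem norm_sum_softmax_smul_le {E : Type*} [NormedAddCommGroup E] [NormedSpace ℝ E]
    (𝒯 : ℝ) (h : H) (s : S) {f : A → E} {c : ℝ} (hf : ∀ a, ‖f a‖ ≤ c) :
    ‖∑ a : A, softmax 𝒯 h s a • f a‖ ≤ c := by
  calc ‖∑ a : A, softmax 𝒯 h s a • f a‖ ≤ ∑ a : A, softmax 𝒯 h s a * c := by
        refine norm_sum_le_of_le _ fun a _ => ?_
        rw [norm_smul, Real.norm_of_nonneg (softmax_pos 𝒯 h s a).le]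
        exact mul_le_mul_of_nonneg_left (hf a) (softmax_pos 𝒯 h s a).le
    _ = c := by rw [← Finset.sum_mul, sum_softmax, one_mul]

theorem norm_meanKer_le (𝒯 : ℝ) (h : H) (s : S) :
    ‖meanKer (A := A) 𝒯 h s‖ ≤ kerNorm (A := A) H s :=
  norm_sum_softmax_smul_le 𝒯 h s fun a => norm_kerSec_le s a

theorem norm_score_le (𝒯 : ℝ) (h : H) (s : S) (a : A) :
    ‖score 𝒯 h s a‖ ≤ 2 * |𝒯| * kerNorm (A := A) H s := by
  rw [score_eq, norm_smul, Real.norm_eq_abs]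
  have := (norm_sub_le (kerSec H (s, a)) (meanKer 𝒯 h s)).trans
    (add_le_add (norm_kerSec_le s a) (norm_meanKer_le 𝒯 h s))
  nlinarith [abs_nonneg 𝒯]

theorem norm_covOp_le (𝒯 : ℝ) (h : H) (s : S) :
    ‖covOp (A := A) 𝒯 h s‖ ≤ 2 * kerNorm (A := A) H s ^ 2 := by
  have h1 : ‖∑ a : A, softmax 𝒯 h s a • outer (kerSec H (s, a)) (kerSec H (s, a))‖ ≤
      kerNorm (A := A) H s * kerNorm (A := A) H s :=
    norm_sum_softmax_smul_le 𝒯 h s fun a => by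
      rw [norm_outer]
      exact mul_self_le_mul_self (norm_nonneg _) (norm_kerSec_le s a)
  have h2 : ‖outer (meanKer (A := A) 𝒯 h s) (meanKer (A := A) 𝒯 h s)‖ ≤
      kerNorm (A := A) H s * kerNorm (A := A) H s := by
    rw [norm_outer]
    exact mul_self_le_mul_self (norm_nonneg _) (norm_meanKer_le 𝒯 h s)
  refine (norm_sub_le _ _).trans ((add_le_add h1 h2).trans (le_of_eq ?_))
  ring

variable [MeasurableSpace S]

omit [Nonempty A] in
theorem stronglyMeasurable_meanKer
    (hK : ∀ a : A, StronglyMeasurable fun s : S => kerSec H (s, a)) (𝒯 : ℝ) (h : H) :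
    StronglyMeasurable fun s : S => meanKer (A := A) 𝒯 h s :=
  Finset.stronglyMeasurable_fun_sum _ fun a _ =>
    (measurable_softmax hK 𝒯 h a).stronglyMeasurable.smul (hK a)

theorem stronglyMeasurable_score
    (hK : ∀ a : A, StronglyMeasurable fun s : S => kerSec H (s, a)) (𝒯 : ℝ) (h : H) (a : A) :
    StronglyMeasurable fun s : S => score 𝒯 h s a := by
  simp_rw [score_eq]
  exact ((hK a).sub (stronglyMeasurable_meanKer hK 𝒯 h)).const_smul 𝒯

omit [Nonempty A] in
theorem stronglyMeasurable_covOp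
    (hK : ∀ a : A, StronglyMeasurable fun s : S => kerSec H (s, a)) (𝒯 : ℝ) (h : H) :
    StronglyMeasurable fun s : S => covOp (A := A) 𝒯 h s := by
  refine StronglyMeasurable.sub (Finset.stronglyMeasurable_fun_sum _ fun a _ =>
    (measurable_softmax hK 𝒯 h a).stronglyMeasurable.smul ?_) ?_
  · exact stronglyMeasurable_outer (hK a) (hK a)
  · exact stronglyMeasurable_outer (stronglyMeasurable_meanKer hK 𝒯 h)
      (stronglyMeasurable_meanKer hK 𝒯 h)

end Softmax

/-! ### Trajectory laws: one-step disintegration and change of measure to the uniform policy. -/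

section Trajectory

/-- Extension of a trajectory by an action and a next state. -/
def extendTraj {S A : Type*} {n : ℕ} (τ : Traj S A n) (a : A) (s : S) : Traj S A (n + 1) :=
  (Fin.snoc τ.1 s, Fin.snoc τ.2 a)

theorem extendTraj_state {S A : Type*} {n : ℕ} (τ : Traj S A n) (a : A) (s : S)
    (t : Fin (n + 1)) : (extendTraj τ a s).1 t.castSucc = τ.1 t := by
  simp [extendTraj]

theorem extendTraj_action_castSucc {S A : Type*} {n : ℕ} (τ : Traj S A n) (a : A) (s : S)
    (t : Fin n) : (extendTraj τ a s).2 t.castSucc = τ.2 t := by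
  simp [extendTraj]

theorem extendTraj_action_last {S A : Type*} {n : ℕ} (τ : Traj S A n) (a : A) (s : S) :
    (extendTraj τ a s).2 (Fin.last n) = a := by
  simp [extendTraj]

theorem measurable_extendTraj {S A : Type*} [MeasurableSpace S] [MeasurableSpace A] (n : ℕ) :
    Measurable fun p : Traj S A n × (A × S) => extendTraj p.1 p.2.1 p.2.2 := by
  have h1 := (measurable_snoc S (n + 1)).comp
    (g := fun p : (Fin (n + 1) → S) × S => (Fin.snoc p.1 p.2 : Fin (n + 2) → S))
    (f := fun p : Traj S A n × (A × S) => (p.1.1, p.2.2)) (by fun_prop)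
  have h2 := (measurable_snoc A n).comp
    (g := fun p : (Fin n → A) × A => (Fin.snoc p.1 p.2 : Fin (n + 1) → A))
    (f := fun p : Traj S A n × (A × S) => (p.1.2, p.2.1)) (by fun_prop)
  exact h1.prodMk h2

section Weight

variable {S A H : Type*} [Fintype A] [NormedAddCommGroup H] [InnerProductSpace ℝ H]
  [RKHS ℝ H (S × A) ℝ]

/-- The likelihood ratio of the softmax policy to the uniform policy along a trajectory. -/
noncomputable def weight {n : ℕ} (𝒯 : ℝ) (h : H) (τ : Traj S A n) : ℝ :=
  ∏ t : Fin n, Fintype.card A * softmax 𝒯 h (τ.1 t.castSucc) (τ.2 t)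

theorem weight_extendTraj {n : ℕ} (𝒯 : ℝ) (h : H) (τ : Traj S A n) (a : A) (s : S) :
    weight 𝒯 h (extendTraj τ a s) =
      weight 𝒯 h τ * (Fintype.card A * softmax 𝒯 h (τ.1 (Fin.last n)) a) := by
  simp only [weight, Fin.prod_univ_castSucc, extendTraj_state, extendTraj_action_castSucc,
    extendTraj_action_last]

theorem weight_pos [Nonempty A] {n : ℕ} (𝒯 : ℝ) (h : H) (τ : Traj S A n) : 0 < weight 𝒯 h τ :=
  Finset.prod_pos fun _ _ => mul_pos (by exact_mod_cast Fintype.card_pos) (softmax_pos _ _ _ _)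

theorem weight_le [Nonempty A] {n : ℕ} (𝒯 : ℝ) (h : H) (τ : Traj S A n) :
    weight 𝒯 h τ ≤ (Fintype.card A : ℝ) ^ n := by
  calc weight 𝒯 h τ ≤ ∏ _t : Fin n, (Fintype.card A : ℝ) :=
        Finset.prod_le_prod (fun _ _ => mul_nonneg (Nat.cast_nonneg _) (softmax_pos _ _ _ _).le)
          fun _ _ => mul_le_of_le_one_right (Nat.cast_nonneg _) (softmax_le_one _ _ _ _)
    _ = (Fintype.card A : ℝ) ^ n := by simp

end Weight

variable {S A H : Type*} [MeasurableSpace S] [Fintype A] [Nonempty A] [MeasurableSpace A]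
  [DiscreteMeasurableSpace A] [NormedAddCommGroup H] [InnerProductSpace ℝ H] [CompleteSpace H]
  [RKHS ℝ H (S × A) ℝ]

omit [Nonempty A] in
theorem lintegral_policy (hK : ∀ a : A, StronglyMeasurable fun s : S => kerSec H (s, a))
    (𝒯 : ℝ) (h : H) (s : S) (f : A → ENNReal) :
    ∫⁻ a, f a ∂(policy hK 𝒯 h s) = ∑ a : A, ENNReal.ofReal (softmax 𝒯 h s a) * f a := by
  change ∫⁻ a, f a ∂(∑ a : A, ENNReal.ofReal (softmax 𝒯 h s a) • Measure.dirac a) = _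
  simp [lintegral_finsetSum_measure, lintegral_dirac]

theorem integral_policy {E : Type*} [NormedAddCommGroup E] [NormedSpace ℝ E] [CompleteSpace E]
    (hK : ∀ a : A, StronglyMeasurable fun s : S => kerSec H (s, a))
    (𝒯 : ℝ) (h : H) (s : S) (f : A → E) :
    ∫ a, f a ∂(policy hK 𝒯 h s) = ∑ a : A, softmax 𝒯 h s a • f a := by
  change ∫ a, f a ∂(∑ a : A, ENNReal.ofReal (softmax 𝒯 h s a) • Measure.dirac a) = _
  rw [integral_finsetSum_measure fun a _ =>
    (Integrable.of_finite (μ := Measure.dirac a)).smul_measure ENNReal.ofReal_ne_top]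
  simp [integral_smul_measure, ENNReal.toReal_ofReal, (softmax_pos 𝒯 h s _).le]

theorem lintegral_trajLaw_succ (M : MDP S A)
    (hK : ∀ a : A, StronglyMeasurable fun s : S => kerSec H (s, a)) (𝒯 : ℝ) (h : H) (n : ℕ)
    {f : Traj S A (n + 1) → ENNReal} (hf : Measurable f) :
    ∫⁻ τ, f τ ∂(trajLaw M (policy hK 𝒯 h) (n + 1)) =
      ∫⁻ τ, ∑ a : A, ENNReal.ofReal (softmax 𝒯 h (τ.1 (Fin.last n)) a) *
        ∫⁻ s', f (extendTraj τ a s') ∂(M.P (τ.1 (Fin.last n), a))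
        ∂(trajLaw M (policy hK 𝒯 h) n) := by
  have := M.markov_P
  have := isMarkovKernel_policy hK 𝒯 h
  have := isProbabilityMeasure_trajLaw M (policy hK 𝒯 h) n
  have hm := measurable_extendTraj (S := S) (A := A) n
  have hfm := hf.comp hm
  rw [trajLaw]
  refine (lintegral_map hf hm).trans ?_
  refine (Measure.lintegral_compProd hfm).trans ?_
  refine lintegral_congr fun τ => ?_
  rw [Kernel.comap_apply]
  refine (Kernel.lintegral_compProd _ _ _ (hfm.comp measurable_prodMk_left)).trans ?_
  exact lintegral_policy hK 𝒯 h _ _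

/-- Fubini for the last step, when the integrand ignores the final state: the transition kernel then
disappears. Integrability of the averaged integrand is part of the conclusion because inductions on
the horizon need it. -/
theorem integral_trajLaw_succ {E : Type*} [NormedAddCommGroup E] [NormedSpace ℝ E]
    [CompleteSpace E] (M : MDP S A)
    (hK : ∀ a : A, StronglyMeasurable fun s : S => kerSec H (s, a)) (𝒯 : ℝ) (h : H) (n : ℕ)
    {f : Traj S A (n + 1) → E} {g : Traj S A n → A → E}
    (hfg : ∀ τ a s, f (extendTraj τ a s) = g τ a)
    (hf : Integrable f (trajLaw M (policy hK 𝒯 h) (n + 1))) :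
    Integrable (fun τ => ∑ a : A, softmax 𝒯 h (τ.1 (Fin.last n)) a • g τ a)
        (trajLaw M (policy hK 𝒯 h) n) ∧
      ∫ τ, f τ ∂(trajLaw M (policy hK 𝒯 h) (n + 1)) =
        ∫ τ, ∑ a : A, softmax 𝒯 h (τ.1 (Fin.last n)) a • g τ a
          ∂(trajLaw M (policy hK 𝒯 h) n) := by
  have := M.markov_P
  have := isMarkovKernel_policy hK 𝒯 h
  have := isProbabilityMeasure_trajLaw M (policy hK 𝒯 h) n
  have hm := measurable_extendTraj (S := S) (A := A) n
  rw [trajLaw] at hf ⊢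
  have hf' : Integrable (fun p : Traj S A n × (A × S) => g p.1 p.2.1)
      (trajLaw M (policy hK 𝒯 h) n ⊗ₘ (policy hK 𝒯 h ⊗ₖ M.P).comap
        (fun τ : Traj S A n => τ.1 (Fin.last n)) (by fun_prop)) :=
    ((integrable_map_measure hf.1 hm.aemeasurable).1 hf).congr
      (Filter.Eventually.of_forall fun p => hfg _ _ _)
  have hinner : ∀ τ : Traj S A n,
      ∫ y : A × S, g τ y.1 ∂((policy hK 𝒯 h ⊗ₖ M.P).comap
        (fun τ : Traj S A n => τ.1 (Fin.last n)) (by fun_prop) τ) =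
      ∑ a : A, softmax 𝒯 h (τ.1 (Fin.last n)) a • g τ a := fun τ => by
    rw [← integral_policy hK, Kernel.comap_apply]
    -- The integrand ignores the next state, so only the action marginal matters; it is the policy
    -- because the transition kernel is Markov.
    conv_rhs => rw [← Kernel.fst_compProd (policy hK 𝒯 h) M.P, Kernel.fst_apply]
    exact (integral_map measurable_fst.aemeasurable
      StronglyMeasurable.of_discrete.aestronglyMeasurable).symm
  have heq := Measure.integral_compProd hf'
  simp only [hinner] at heq
  refine ⟨?_, ?_⟩
  · refine Integrable.congr ?_ (Filter.Eventually.of_forall hinner)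
    -- The composition-product of a measure and a kernel is, by definition, one of kernels over a
    -- one-point space.
    exact Integrable.integral_compProd (κ := Kernel.const Unit (trajLaw M (policy hK 𝒯 h) n))
      (η := Kernel.prodMkLeft Unit ((policy hK 𝒯 h ⊗ₖ M.P).comap
        (fun τ : Traj S A n => τ.1 (Fin.last n)) (by fun_prop))) (a := ()) hf'
  · rw [← heq]
    refine (integral_map hm.aemeasurable hf.1).trans ?_
    exact integral_congr_ae (Filter.Eventually.of_forall fun p => hfg _ _ _)

omit [Nonempty A] in
theorem measurable_softmax_traj
    (hK : ∀ a : A, StronglyMeasurable fun s : S => kerSec H (s, a)) {n : ℕ} (𝒯 : ℝ) (h : H)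
    (t : Fin n) :
    Measurable fun τ : Traj S A n => softmax 𝒯 h (τ.1 t.castSucc) (τ.2 t) := by
  have : Measurable fun p : S × A => softmax 𝒯 h p.1 p.2 :=
    measurable_from_prod_countable_left fun a => measurable_softmax hK 𝒯 h a
  exact this.comp (g := fun p : S × A => softmax 𝒯 h p.1 p.2)
    (f := fun τ : Traj S A n => (τ.1 t.castSucc, τ.2 t)) (by fun_prop)

omit [Nonempty A] in
theorem measurable_weight
    (hK : ∀ a : A, StronglyMeasurable fun s : S => kerSec H (s, a)) {n : ℕ} (𝒯 : ℝ) (h : H) :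
    Measurable fun τ : Traj S A n => weight 𝒯 h τ :=
  Finset.measurable_fun_prod _ fun t _ => (measurable_softmax_traj hK 𝒯 h t).const_mul _

/-- Each step contributes only the ratio of the action probabilities, π_h(a ∣ s) against 1/|A|. -/
theorem trajLaw_eq_withDensity (M : MDP S A)
    (hK : ∀ a : A, StronglyMeasurable fun s : S => kerSec H (s, a)) (𝒯 : ℝ) (h : H) (n : ℕ) :
    trajLaw M (policy hK 𝒯 h) n =
      (trajLaw M (policy hK 𝒯 (0 : H)) n).withDensity fun τ => ENNReal.ofReal (weight 𝒯 h τ) := by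
  have := M.markov_P
  induction n with
  | zero => simp [trajLaw, weight]
  | succ n ih =>
    have hw : ∀ n, Measurable fun τ : Traj S A n => ENNReal.ofReal (weight 𝒯 h τ) :=
      fun n => (measurable_weight hK 𝒯 h).ennreal_ofReal
    refine Measure.ext_of_lintegral _ fun f hf => ?_
    have hin : Measurable fun τ : Traj S A n =>
        ∑ a : A, ENNReal.ofReal (softmax 𝒯 h (τ.1 (Fin.last n)) a) *
          ∫⁻ s', f (extendTraj τ a s') ∂(M.P (τ.1 (Fin.last n), a)) := by
      refine Finset.measurable_fun_sum _ fun a _ => Measurable.mul ?_ ?_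
      · exact ((measurable_softmax hK 𝒯 h a).comp
          (f := fun τ : Traj S A n => τ.1 (Fin.last n)) (by fun_prop)).ennreal_ofReal
      · have hk : Measurable fun τ : Traj S A n => (τ.1 (Fin.last n), a) := by fun_prop
        refine Measurable.lintegral_kernel_prod_right (κ := M.P.comap _ hk) ?_
        exact hf.comp ((measurable_extendTraj n).comp
          (f := fun p : Traj S A n × S => (p.1, (a, p.2))) (by fun_prop))
    rw [lintegral_trajLaw_succ M hK 𝒯 h n hf, ih,
      lintegral_withDensity_eq_lintegral_mul _ (hw n) hin,
      lintegral_withDensity_eq_lintegral_mul _ (hw _) hf,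
      lintegral_trajLaw_succ M hK 𝒯 0 n ((hw _).mul hf)]
    refine lintegral_congr fun τ => ?_
    simp only [Pi.mul_apply, Finset.mul_sum]
    refine Finset.sum_congr rfl fun a _ => ?_
    simp only [weight_extendTraj]
    rw [lintegral_const_mul' _ _ ENNReal.ofReal_ne_top, ← mul_assoc, ← mul_assoc,
      ← ENNReal.ofReal_mul (weight_pos _ _ _).le, ← ENNReal.ofReal_mul (softmax_pos _ _ _ _).le,
      softmax_zero]
    congr 2
    field_simp

/-- The bounded density carries integrability from the uniform policy to every π_h. -/
theorem trajLaw_le_smul (M : MDP S A)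
    (hK : ∀ a : A, StronglyMeasurable fun s : S => kerSec H (s, a)) (𝒯 : ℝ) (h : H) (n : ℕ) :
    trajLaw M (policy hK 𝒯 h) n ≤
      ENNReal.ofReal ((Fintype.card A : ℝ) ^ n) • trajLaw M (policy hK 𝒯 (0 : H)) n := by
  rw [trajLaw_eq_withDensity M hK 𝒯 h, ← withDensity_const]
  exact withDensity_mono (Filter.Eventually.of_forall fun τ =>
    ENNReal.ofReal_le_ofReal (weight_le 𝒯 h τ))

theorem integral_trajLaw_eq {E : Type*} [NormedAddCommGroup E] [NormedSpace ℝ E] (M : MDP S A)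
    (hK : ∀ a : A, StronglyMeasurable fun s : S => kerSec H (s, a)) (𝒯 : ℝ) (h : H) (n : ℕ)
    (f : Traj S A n → E) :
    ∫ τ, f τ ∂(trajLaw M (policy hK 𝒯 h) n) =
      ∫ τ, weight 𝒯 h τ • f τ ∂(trajLaw M (policy hK 𝒯 (0 : H)) n) := by
  rw [trajLaw_eq_withDensity M hK 𝒯 h, integral_withDensity_eq_integral_toReal_smul
    (measurable_weight hK 𝒯 h).ennreal_ofReal
    (Filter.Eventually.of_forall fun _ => ENNReal.ofReal_lt_top)]
  simp only [ENNReal.toReal_ofReal (weight_pos 𝒯 h _).le]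

theorem integrable_trajLaw (M : MDP S A)
    (hK : ∀ a : A, StronglyMeasurable fun s : S => kerSec H (s, a)) (𝒯 : ℝ) (h : H) {n : ℕ}
    {E : Type*} [NormedAddCommGroup E] {f : Traj S A n → E}
    (hf : Integrable f (trajLaw M (policy hK 𝒯 (0 : H)) n)) :
    Integrable f (trajLaw M (policy hK 𝒯 h) n) :=
  hf.of_measure_le_smul ENNReal.ofReal_ne_top (trajLaw_le_smul M hK 𝒯 h n)

end Trajectory

/-! ### Returns and rewards to go, and their change under one more step. -/

section Return

variable {S A : Type*} [MeasurableSpace S] [MeasurableSpace A]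

/-- The discounted return of a trajectory. -/
noncomputable def trajReturn {n : ℕ} (M : MDP S A) (τ : Traj S A n) : ℝ :=
  ∑ t : Fin n, M.γ ^ ((t : ℤ) - 1) * M.r (τ.1 t.castSucc, τ.2 t)

/-- The sum of the absolute values of the discounted rewards of a trajectory. -/
noncomputable def absReturn {n : ℕ} (M : MDP S A) (τ : Traj S A n) : ℝ :=
  ∑ t : Fin n, |M.γ ^ ((t : ℤ) - 1) * M.r (τ.1 t.castSucc, τ.2 t)|

theorem abs_trajReturn_le {n : ℕ} (M : MDP S A) (τ : Traj S A n) :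
    |trajReturn M τ| ≤ absReturn M τ :=
  Finset.abs_sum_le_sum_abs _ _

theorem absReturn_nonneg {n : ℕ} (M : MDP S A) (τ : Traj S A n) : 0 ≤ absReturn M τ :=
  Finset.sum_nonneg fun _ _ => abs_nonneg _

theorem abs_rewardToGo_le {n : ℕ} (M : MDP S A) (t : Fin n) (τ : Traj S A n) :
    |rewardToGo M t τ| ≤ absReturn M τ :=
  (Finset.abs_sum_le_sum_abs _ _).trans <|
    Finset.sum_le_sum_of_subset_of_nonneg (Finset.filter_subset _ _) fun _ _ _ => abs_nonneg _

theorem trajReturn_extendTraj {n : ℕ} (M : MDP S A) (τ : Traj S A n) (a : A) (s : S) :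
    trajReturn M (extendTraj τ a s) =
      trajReturn M τ + M.γ ^ ((n : ℤ) - 1) * M.r (τ.1 (Fin.last n), a) := by
  simp only [trajReturn, Fin.sum_univ_castSucc, extendTraj_state, extendTraj_action_castSucc,
    extendTraj_action_last, Fin.val_castSucc, Fin.val_last]

theorem rewardToGo_extendTraj_castSucc {n : ℕ} (M : MDP S A) (t : Fin n) (τ : Traj S A n)
    (a : A) (s : S) :
    rewardToGo M t.castSucc (extendTraj τ a s) =
      rewardToGo M t τ + M.γ ^ ((n : ℤ) - 1) * M.r (τ.1 (Fin.last n), a) := by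
  simp only [rewardToGo, Finset.sum_filter, Fin.sum_univ_castSucc, extendTraj_state,
    extendTraj_action_castSucc, extendTraj_action_last, Fin.val_castSucc, Fin.val_last,
    Fin.castSucc_le_castSucc_iff, Fin.le_last, if_true]

theorem rewardToGo_extendTraj_last {n : ℕ} (M : MDP S A) (τ : Traj S A n) (a : A) (s : S) :
    rewardToGo M (Fin.last n) (extendTraj τ a s) =
      M.γ ^ ((n : ℤ) - 1) * M.r (τ.1 (Fin.last n), a) := by
  simp only [rewardToGo, Finset.sum_filter, Fin.sum_univ_castSucc, extendTraj_state,
    extendTraj_action_last, Fin.val_last, le_refl, if_true]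
  simp

end Return

/-! ### Derivatives of the likelihood ratio and the reward-to-go identity. -/

section Hessian

variable {S A H : Type*} [Fintype A] [NormedAddCommGroup H] [InnerProductSpace ℝ H]
  [CompleteSpace H] [RKHS ℝ H (S × A) ℝ]

/-- The score of a trajectory. -/
noncomputable def scoreSum {n : ℕ} (𝒯 : ℝ) (h : H) (τ : Traj S A n) : H :=
  ∑ t : Fin n, score 𝒯 h (τ.1 t.castSucc) (τ.2 t)

/-- The sum of the covariance operators along a trajectory. -/
noncomputable def covSum {n : ℕ} (𝒯 : ℝ) (h : H) (τ : Traj S A n) : HTensor H :=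
  ∑ t : Fin n, covOp 𝒯 h (τ.1 t.castSucc)

/-- The second logarithmic derivative `w⁻¹ ∇² w` of the likelihood ratio `w`. -/
noncomputable def weightHess {n : ℕ} (𝒯 : ℝ) (h : H) (τ : Traj S A n) : HTensor H :=
  outer (scoreSum 𝒯 h τ) (scoreSum 𝒯 h τ) - 𝒯 ^ 2 • covSum 𝒯 h τ

/-- The sum over the states of a trajectory of the norms of the kernel sections. -/
noncomputable def trajKerNorm (H : Type*) [NormedAddCommGroup H] [InnerProductSpace ℝ H]
    [CompleteSpace H] [RKHS ℝ H (S × A) ℝ] {n : ℕ} (τ : Traj S A n) : ℝ :=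
  ∑ t : Fin n, kerNorm (A := A) H (τ.1 t.castSucc)

theorem trajKerNorm_nonneg {n : ℕ} (τ : Traj S A n) : 0 ≤ trajKerNorm H τ :=
  Finset.sum_nonneg fun _ _ => kerNorm_nonneg _

theorem sum_kerNorm_sq_le {n : ℕ} (τ : Traj S A n) :
    ∑ t : Fin n, kerNorm (A := A) H (τ.1 t.castSucc) ^ 2 ≤ trajKerNorm H τ ^ 2 :=
  Finset.sum_sq_le_sq_sum_of_nonneg fun _ _ => kerNorm_nonneg _

/-- Cauchy–Schwarz over times and over actions brings in K(x, x) = ‖K(x, ·)‖², the quantity in the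
moment condition. -/
theorem trajKerNorm_sq_le {n : ℕ} (τ : Traj S A n) :
    trajKerNorm H τ ^ 2 ≤ n * ∑ t : Fin n, (Fintype.card A * ∑ a : A,
      kerSec H (τ.1 t.castSucc, a) (τ.1 t.castSucc, a)) := by
  refine sq_sum_le_card_mul_sum_sq.trans ?_
  rw [Finset.card_univ, Fintype.card_fin]
  refine mul_le_mul_of_nonneg_left (Finset.sum_le_sum fun t _ => ?_) (Nat.cast_nonneg _)
  refine sq_sum_le_card_mul_sum_sq.trans ?_
  rw [Finset.card_univ]
  refine mul_le_mul_of_nonneg_left (Finset.sum_le_sum fun a _ => ?_) (Nat.cast_nonneg _)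
  rw [eval_eq_inner, real_inner_self_eq_norm_sq]

section Bounds

variable [Nonempty A]

theorem hasFDerivAt_weight {n : ℕ} (𝒯 : ℝ) (h : H) (τ : Traj S A n) :
    HasFDerivAt (fun h : H => weight 𝒯 h τ) (weight 𝒯 h τ • innerSL ℝ (scoreSum 𝒯 h τ)) h := by
  classical
  refine (HasFDerivAt.finsetProd (u := Finset.univ) fun t _ =>
    (hasFDerivAt_softmax 𝒯 h (τ.1 t.castSucc) (τ.2 t)).const_mul
      (Fintype.card A : ℝ)).congr_fderiv ?_
  rw [scoreSum, map_sum, Finset.smul_sum]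
  refine Finset.sum_congr rfl fun t ht => ?_
  rw [smul_smul, smul_smul, weight, ← Finset.mul_prod_erase _ _ ht]
  congr 1
  ring

theorem hasFDerivAt_scoreSum {n : ℕ} (𝒯 : ℝ) (h : H) (τ : Traj S A n) :
    HasFDerivAt (fun h : H => scoreSum 𝒯 h τ) (-(tensorOpL H (𝒯 ^ 2 • covSum 𝒯 h τ))) h := by
  refine (HasFDerivAt.fun_sum (u := Finset.univ) fun t _ =>
    hasFDerivAt_score 𝒯 h (τ.1 t.castSucc) (τ.2 t)).congr_fderiv ?_
  rw [covSum, Finset.smul_sum, map_sum, Finset.sum_neg_distrib]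

/-- Product rule for ∇w = w S: differentiating w yields S ⊗ S, differentiating S yields the
covariances. -/
theorem hasFDerivAt_weight_smul_scoreSum {n : ℕ} (𝒯 : ℝ) (h : H) (τ : Traj S A n) :
    HasFDerivAt (fun h : H => weight 𝒯 h τ • scoreSum 𝒯 h τ)
      (weight 𝒯 h τ • tensorOpL H (weightHess 𝒯 h τ)) h := by
  refine ((hasFDerivAt_weight 𝒯 h τ).smul (hasFDerivAt_scoreSum 𝒯 h τ)).congr_fderiv ?_
  refine ContinuousLinearMap.ext fun v => ?_
  simp only [weightHess, map_sub, add_apply, smul_apply, sub_apply, neg_apply,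
    ContinuousLinearMap.smulRight_apply, innerSL_apply_apply]
  rw [tensorOpL_apply (outer _ _), tensorOp_outer]
  module

theorem norm_scoreSum_le {n : ℕ} (𝒯 : ℝ) (h : H) (τ : Traj S A n) :
    ‖scoreSum 𝒯 h τ‖ ≤ 2 * |𝒯| * trajKerNorm H τ := by
  rw [trajKerNorm, Finset.mul_sum]
  exact norm_sum_le_of_le _ fun t _ => norm_score_le _ _ _ _

theorem norm_covSum_le {n : ℕ} (𝒯 : ℝ) (h : H) (τ : Traj S A n) :
    ‖covSum 𝒯 h τ‖ ≤ 2 * trajKerNorm H τ ^ 2 := by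
  refine (norm_sum_le_of_le _ fun t _ => norm_covOp_le _ _ _).trans ?_
  rw [← Finset.mul_sum]
  exact mul_le_mul_of_nonneg_left (sum_kerNorm_sq_le τ) zero_le_two

/-- The constant is 6 = 4 + 2: the squared score bound gives 4, the covariance bound 2. -/
theorem norm_weightHess_le {n : ℕ} (𝒯 : ℝ) (h : H) (τ : Traj S A n) :
    ‖weightHess 𝒯 h τ‖ ≤ 6 * 𝒯 ^ 2 * trajKerNorm H τ ^ 2 := by
  refine (norm_sub_le _ _).trans ?_
  rw [norm_outer, norm_smul, Real.norm_of_nonneg (sq_nonneg 𝒯)]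
  have h1 := mul_self_le_mul_self (norm_nonneg _) (norm_scoreSum_le 𝒯 h τ)
  have h2 := mul_le_mul_of_nonneg_left (norm_covSum_le 𝒯 h τ) (sq_nonneg 𝒯)
  have h3 := sq_abs 𝒯
  nlinarith

end Bounds

variable [MeasurableSpace S] [MeasurableSpace A]

/-- The reward-weighted score `∑_t Ψ_t ∇ log π(a_t ∣ s_t)`. -/
noncomputable def rewardScore {n : ℕ} (M : MDP S A) (𝒯 : ℝ) (h : H) (τ : Traj S A n) : H :=
  ∑ t : Fin n, rewardToGo M t τ • score 𝒯 h (τ.1 t.castSucc) (τ.2 t)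

theorem norm_hessIntegrand_le [Nonempty A] {n : ℕ} (M : MDP S A) (𝒯 : ℝ) (h : H)
    (τ : Traj S A n) :
    ‖hessIntegrand M 𝒯 h τ‖ ≤ 6 * 𝒯 ^ 2 * (absReturn M τ * trajKerNorm H τ ^ 2) := by
  have h1 : ‖rewardScore M 𝒯 h τ‖ ≤ absReturn M τ * (2 * |𝒯| * trajKerNorm H τ) := by
    rw [trajKerNorm, Finset.mul_sum, Finset.mul_sum]
    refine norm_sum_le_of_le _ fun t _ => ?_
    rw [norm_smul]
    exact mul_le_mul (abs_rewardToGo_le M t τ) (norm_score_le _ _ _ _) (norm_nonneg _)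
      (absReturn_nonneg M τ)
  have h2 : ‖∑ t : Fin n, (rewardToGo M t τ * 𝒯 ^ 2) • covOp (A := A) 𝒯 h (τ.1 t.castSucc)‖ ≤
      absReturn M τ * 𝒯 ^ 2 * (2 * trajKerNorm H τ ^ 2) := by
    refine (norm_sum_le_of_le (n := fun t => absReturn M τ * 𝒯 ^ 2 *
      (2 * kerNorm (A := A) H (τ.1 t.castSucc) ^ 2)) _ fun t _ => ?_).trans ?_
    · rw [norm_smul, norm_mul, Real.norm_of_nonneg (sq_nonneg 𝒯)]
      exact mul_le_mul (mul_le_mul_of_nonneg_right (abs_rewardToGo_le M t τ) (sq_nonneg 𝒯))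
        (norm_covOp_le _ _ _) (norm_nonneg _) (mul_nonneg (absReturn_nonneg M τ) (sq_nonneg 𝒯))
    · rw [← Finset.mul_sum, ← Finset.mul_sum]
      exact mul_le_mul_of_nonneg_left
        (mul_le_mul_of_nonneg_left (sum_kerNorm_sq_le τ) zero_le_two)
        (mul_nonneg (absReturn_nonneg M τ) (sq_nonneg 𝒯))
  have h3 := mul_le_mul h1 (norm_scoreSum_le 𝒯 h τ) (norm_nonneg _)
    ((norm_nonneg _).trans h1)
  have h4 : ‖hessIntegrand M 𝒯 h τ‖ ≤ ‖rewardScore M 𝒯 h τ‖ * ‖scoreSum 𝒯 h τ‖ +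
      ‖∑ t : Fin n, (rewardToGo M t τ * 𝒯 ^ 2) • covOp (A := A) 𝒯 h (τ.1 t.castSucc)‖ := by
    rw [← norm_outer]
    exact norm_sub_le _ _
  refine h4.trans ((add_le_add h3 h2).trans (le_of_eq ?_))
  linear_combination 4 * absReturn M τ * trajKerNorm H τ ^ 2 * sq_abs 𝒯

/-- The new reward adds to the return and to every reward to go, the new one included, so it
multiplies the same expression in both integrands and cancels. Hence the new action enters only
through its score, and the next state not at all. -/
theorem return_smul_weightHess_sub_hessIntegrand_extendTraj {n : ℕ} (M : MDP S A) (𝒯 : ℝ)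
    (h : H) (τ : Traj S A n) (a : A) (s : S) :
    trajReturn M (extendTraj τ a s) • weightHess 𝒯 h (extendTraj τ a s) -
        hessIntegrand M 𝒯 h (extendTraj τ a s) =
      (trajReturn M τ • weightHess 𝒯 h τ - hessIntegrand M 𝒯 h τ)
        + outerL H (trajReturn M τ • scoreSum 𝒯 h τ - rewardScore M 𝒯 h τ)
          (score 𝒯 h (τ.1 (Fin.last n)) a)
        + (outerL H).flip (trajReturn M τ • scoreSum 𝒯 h τ) (score 𝒯 h (τ.1 (Fin.last n)) a)
        + trajReturn M τ • (outer (score 𝒯 h (τ.1 (Fin.last n)) a)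
            (score 𝒯 h (τ.1 (Fin.last n)) a) - 𝒯 ^ 2 • covOp 𝒯 h (τ.1 (Fin.last n))) := by
  simp only [weightHess, hessIntegrand, trajReturn_extendTraj, scoreSum, covSum, rewardScore,
    Fin.sum_univ_castSucc (n := n), extendTraj_state, extendTraj_action_castSucc,
    extendTraj_action_last, rewardToGo_extendTraj_castSucc, rewardToGo_extendTraj_last]
  simp only [← outerL_apply, ContinuousLinearMap.flip_apply, map_add, map_sub, map_smul,
    add_apply, sub_apply, smul_apply, add_smul, add_mul, Finset.sum_add_distrib, mul_smul,
    ← Finset.smul_sum]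
  module

theorem sum_softmax_smul_weightHess_sub_hessIntegrand [Nonempty A] {n : ℕ} (M : MDP S A) (𝒯 : ℝ)
    (h : H) (τ : Traj S A n) :
    ∑ a : A, softmax 𝒯 h (τ.1 (Fin.last n)) a •
      ((trajReturn M τ • weightHess 𝒯 h τ - hessIntegrand M 𝒯 h τ)
        + outerL H (trajReturn M τ • scoreSum 𝒯 h τ - rewardScore M 𝒯 h τ)
          (score 𝒯 h (τ.1 (Fin.last n)) a)
        + (outerL H).flip (trajReturn M τ • scoreSum 𝒯 h τ) (score 𝒯 h (τ.1 (Fin.last n)) a)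
        + trajReturn M τ • (outer (score 𝒯 h (τ.1 (Fin.last n)) a)
            (score 𝒯 h (τ.1 (Fin.last n)) a) - 𝒯 ^ 2 • covOp 𝒯 h (τ.1 (Fin.last n)))) =
      trajReturn M τ • weightHess 𝒯 h τ - hessIntegrand M 𝒯 h τ := by
  have hL : ∀ L : H →L[ℝ] HTensor H, ∑ a : A, softmax 𝒯 h (τ.1 (Fin.last n)) a •
      L (score 𝒯 h (τ.1 (Fin.last n)) a) = 0 := fun L => by
    simp_rw [← map_smul, ← map_sum, sum_softmax_smul_score, map_zero]
  simp only [smul_add, Finset.sum_add_distrib, hL, smul_comm _ (trajReturn M τ), smul_sub,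
    Finset.sum_sub_distrib, ← Finset.smul_sum, sum_softmax_smul_outer_score, ← Finset.sum_smul,
    sum_softmax, one_smul]
  abel

variable [Nonempty A] [DiscreteMeasurableSpace A]

/-- Integrability is assumed only for the difference, at the given horizon; disintegration hands it
down to shorter horizons, so no moment conditions are needed there. -/
theorem integral_return_smul_weightHess_sub_hessIntegrand (M : MDP S A)
    (hK : ∀ a : A, StronglyMeasurable fun s : S => kerSec H (s, a)) (𝒯 : ℝ) (h : H) (n : ℕ)
    (hint : Integrable
      (fun τ : Traj S A n => trajReturn M τ • weightHess 𝒯 h τ - hessIntegrand M 𝒯 h τ)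
      (trajLaw M (policy hK 𝒯 h) n)) :
    ∫ τ, (trajReturn M τ • weightHess 𝒯 h τ - hessIntegrand M 𝒯 h τ)
      ∂(trajLaw M (policy hK 𝒯 h) n) = 0 := by
  induction n with
  | zero =>
    simp [trajReturn, hessIntegrand, ← outerL_apply]
  | succ n ih =>
    obtain ⟨h1, h2⟩ := integral_trajLaw_succ M hK 𝒯 h n
      (fun τ a s => return_smul_weightHess_sub_hessIntegrand_extendTraj M 𝒯 h τ a s) hint
    simp only [sum_softmax_smul_weightHess_sub_hessIntegrand] at h1 h2
    rw [h2, ih h1]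

end Hessian

/-! ### Measurability along trajectories and integrability of the dominating functions. -/

section Measurability

variable {S A H : Type*} [MeasurableSpace S] [Fintype A] [Nonempty A] [MeasurableSpace A]
  [DiscreteMeasurableSpace A] [NormedAddCommGroup H] [InnerProductSpace ℝ H] [CompleteSpace H]
  [RKHS ℝ H (S × A) ℝ]

omit [Fintype A] [Nonempty A] [DiscreteMeasurableSpace A] in
theorem measurable_trajReturn {n : ℕ} (M : MDP S A) :
    Measurable fun τ : Traj S A n => trajReturn M τ := by
  have := M.measurable_r
  unfold trajReturn
  fun_prop

theorem stronglyMeasurable_score_traj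
    (hK : ∀ a : A, StronglyMeasurable fun s : S => kerSec H (s, a)) {n : ℕ} (𝒯 : ℝ) (h : H)
    (t : Fin n) :
    StronglyMeasurable fun τ : Traj S A n => score 𝒯 h (τ.1 t.castSucc) (τ.2 t) := by
  classical
  -- Indicators of the finitely many actions reduce joint measurability to measurability in the
  -- state.
  have heq : (fun τ : Traj S A n => score 𝒯 h (τ.1 t.castSucc) (τ.2 t)) =
      fun τ => ∑ a : A, (if τ.2 t = a then (1 : ℝ) else 0) • score 𝒯 h (τ.1 t.castSucc) a := by
    ext1 τ
    simp
  rw [heq]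
  refine Finset.stronglyMeasurable_fun_sum _ fun a _ => StronglyMeasurable.smul ?_ ?_
  · have : Measurable fun b : A => if b = a then (1 : ℝ) else 0 := .of_discrete
    exact (this.comp (f := fun τ : Traj S A n => τ.2 t) (by fun_prop)).stronglyMeasurable
  · exact (stronglyMeasurable_score hK 𝒯 h a).comp_measurable
      (g := fun τ : Traj S A n => τ.1 t.castSucc) (by fun_prop)

theorem stronglyMeasurable_scoreSum
    (hK : ∀ a : A, StronglyMeasurable fun s : S => kerSec H (s, a)) {n : ℕ} (𝒯 : ℝ) (h : H) :
    StronglyMeasurable fun τ : Traj S A n => scoreSum 𝒯 h τ :=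
  Finset.stronglyMeasurable_fun_sum _ fun t _ => stronglyMeasurable_score_traj hK 𝒯 h t

omit [Nonempty A] [DiscreteMeasurableSpace A] in
theorem stronglyMeasurable_covOp_traj
    (hK : ∀ a : A, StronglyMeasurable fun s : S => kerSec H (s, a)) {n : ℕ} (𝒯 : ℝ) (h : H)
    (t : Fin n) :
    StronglyMeasurable fun τ : Traj S A n => covOp (A := A) 𝒯 h (τ.1 t.castSucc) :=
  (stronglyMeasurable_covOp hK 𝒯 h).comp_measurable
    (g := fun τ : Traj S A n => τ.1 t.castSucc) (by fun_prop)

theorem stronglyMeasurable_weightHess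
    (hK : ∀ a : A, StronglyMeasurable fun s : S => kerSec H (s, a)) {n : ℕ} (𝒯 : ℝ) (h : H) :
    StronglyMeasurable fun τ : Traj S A n => weightHess 𝒯 h τ :=
  (stronglyMeasurable_outer (stronglyMeasurable_scoreSum hK 𝒯 h)
    (stronglyMeasurable_scoreSum hK 𝒯 h)).sub
    ((Finset.stronglyMeasurable_fun_sum _ fun t _ =>
      stronglyMeasurable_covOp_traj hK 𝒯 h t).fun_const_smul _)

theorem stronglyMeasurable_hessIntegrand (M : MDP S A)
    (hK : ∀ a : A, StronglyMeasurable fun s : S => kerSec H (s, a)) {n : ℕ} (𝒯 : ℝ) (h : H) :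
    StronglyMeasurable fun τ : Traj S A n => hessIntegrand M 𝒯 h τ := by
  have hΨ : ∀ t : Fin n, Measurable fun τ : Traj S A n => rewardToGo M t τ := fun t => by
    have := M.measurable_r
    unfold rewardToGo
    fun_prop
  refine (stronglyMeasurable_outer ?_ (stronglyMeasurable_scoreSum hK 𝒯 h)).sub ?_
  · exact Finset.stronglyMeasurable_fun_sum _ fun t _ =>
      (hΨ t).stronglyMeasurable.smul (stronglyMeasurable_score_traj hK 𝒯 h t)
  · exact Finset.stronglyMeasurable_fun_sum _ fun t _ =>
      ((hΨ t).mul_const _).stronglyMeasurable.smul (stronglyMeasurable_covOp_traj hK 𝒯 h t)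

omit [Nonempty A] [DiscreteMeasurableSpace A] in
theorem measurable_trajKerNorm
    (hK : ∀ a : A, StronglyMeasurable fun s : S => kerSec H (s, a)) {n : ℕ} :
    Measurable fun τ : Traj S A n => trajKerNorm H τ := by
  have : Measurable fun s : S => kerNorm (A := A) H s :=
    Finset.measurable_fun_sum _ fun a _ => (hK a).norm.measurable
  exact Finset.measurable_fun_sum _ fun t _ =>
    this.comp (f := fun τ : Traj S A n => τ.1 t.castSucc) (by fun_prop)

omit [Fintype A] [Nonempty A] [DiscreteMeasurableSpace A] in
theorem integrable_absReturn (M : MDP S A) {n : ℕ} {μ : Measure (Traj S A n)}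
    (hr : ∀ i : Fin n, Integrable (fun τ => M.r (τ.1 i.castSucc, τ.2 i)) μ) :
    Integrable (fun τ => absReturn M τ) μ :=
  integrable_finsetSum _ fun i _ => ((hr i).const_mul _).abs

omit [Nonempty A] [DiscreteMeasurableSpace A] in
theorem integrable_absReturn_mul_trajKerNorm_sq (M : MDP S A)
    (hK : ∀ a : A, StronglyMeasurable fun s : S => kerSec H (s, a)) {n : ℕ}
    {μ : Measure (Traj S A n)}
    (hrK : ∀ (i t : Fin n) (a : A), Integrable (fun τ => M.r (τ.1 i.castSucc, τ.2 i) *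
      kerSec H (τ.1 t.castSucc, a) (τ.1 t.castSucc, a)) μ) :
    Integrable (fun τ => absReturn M τ * trajKerNorm H τ ^ 2) μ := by
  have hbound : Integrable (fun τ : Traj S A n => n * (Fintype.card A *
      ∑ i : Fin n, ∑ t : Fin n, ∑ a : A, |M.γ ^ ((i : ℤ) - 1)| *
        |M.r (τ.1 i.castSucc, τ.2 i) *
          kerSec H (τ.1 t.castSucc, a) (τ.1 t.castSucc, a)|)) μ :=
    ((integrable_finsetSum _ fun i _ => integrable_finsetSum _ fun t _ =>
      integrable_finsetSum _ fun a _ => ((hrK i t a).abs.const_mul _)).const_mul _).const_mul _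
  have hmeas : Measurable fun τ : Traj S A n => absReturn M τ * trajKerNorm H τ ^ 2 := by
    have := M.measurable_r
    refine Measurable.mul ?_ ((measurable_trajKerNorm hK).pow_const 2)
    unfold absReturn
    fun_prop
  refine hbound.mono' hmeas.aestronglyMeasurable (Filter.Eventually.of_forall fun τ => ?_)
  rw [Real.norm_of_nonneg (mul_nonneg (absReturn_nonneg M τ) (sq_nonneg _))]
  refine (mul_le_mul_of_nonneg_left (trajKerNorm_sq_le τ) (absReturn_nonneg M τ)).trans
    (le_of_eq ?_)
  have hk : ∀ (t : Fin n) (a : A), 0 ≤ kerSec H (τ.1 t.castSucc, a) (τ.1 t.castSucc, a) :=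
    fun t a => by
      rw [eval_eq_inner]
      exact real_inner_self_nonneg
  rw [← Finset.mul_sum, mul_left_comm, mul_left_comm (absReturn M τ), absReturn,
    Finset.sum_mul_sum]
  simp only [abs_mul, abs_of_nonneg (hk _ _), Finset.mul_sum, mul_assoc]

end Measurability

/-! ### Differentiation under the expectation. -/

section Derivatives

variable {S A H : Type*} [MeasurableSpace S] [Fintype A] [Nonempty A] [MeasurableSpace A]
  [DiscreteMeasurableSpace A] [NormedAddCommGroup H] [InnerProductSpace ℝ H] [CompleteSpace H]
  [RKHS ℝ H (S × A) ℝ] (M : MDP S A)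
  (hK : ∀ a : A, StronglyMeasurable fun s : S => kerSec H (s, a))

omit [DiscreteMeasurableSpace A] in
theorem norm_return_smul_weightHess_le {n : ℕ} (𝒯 : ℝ) (h : H) (τ : Traj S A n) :
    ‖trajReturn M τ • weightHess 𝒯 h τ‖ ≤
      6 * 𝒯 ^ 2 * (absReturn M τ * trajKerNorm H τ ^ 2) := by
  rw [norm_smul]
  refine (mul_le_mul (abs_trajReturn_le M τ) (norm_weightHess_le 𝒯 h τ) (norm_nonneg _)
    (absReturn_nonneg M τ)).trans (le_of_eq ?_)
  ring

omit [DiscreteMeasurableSpace A] in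
theorem norm_return_smul_scoreSum_le {n : ℕ} (𝒯 : ℝ) (h : H) (τ : Traj S A n) :
    ‖trajReturn M τ • scoreSum 𝒯 h τ‖ ≤
      2 * |𝒯| * (absReturn M τ + absReturn M τ * trajKerNorm H τ ^ 2) := by
  rw [norm_smul]
  -- The gradient needs a moment of first order in the kernel norm; this inequality places it
  -- between the two assumed moments, of orders zero and two.
  have h1 : trajKerNorm H τ ≤ 1 + trajKerNorm H τ ^ 2 := by
    nlinarith [sq_nonneg (trajKerNorm H τ - 1), trajKerNorm_nonneg (H := H) τ]
  refine (mul_le_mul (abs_trajReturn_le M τ) ((norm_scoreSum_le 𝒯 h τ).trans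
    (mul_le_mul_of_nonneg_left h1 (by positivity))) (norm_nonneg _)
    (absReturn_nonneg M τ)).trans (le_of_eq ?_)
  ring

omit [MeasurableSpace S] [MeasurableSpace A] [DiscreteMeasurableSpace A] [CompleteSpace H] in
theorem norm_weight_smul_le {E : Type*} [NormedAddCommGroup E] [NormedSpace ℝ E] {n : ℕ} (𝒯 : ℝ)
    (h : H) (τ : Traj S A n) {x : E} {c : ℝ} (hx : ‖x‖ ≤ c) :
    ‖weight 𝒯 h τ • x‖ ≤ (Fintype.card A : ℝ) ^ n * c := by
  rw [norm_smul, Real.norm_of_nonneg (weight_pos 𝒯 h τ).le]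
  exact mul_le_mul (weight_le 𝒯 h τ) hx (norm_nonneg _) (by positivity)

variable {T : ℕ} {𝒯 : ℝ}
  (hr : ∀ i : Fin T,
    Integrable (fun τ => M.r (τ.1 i.castSucc, τ.2 i)) (trajLaw M (policy hK 𝒯 (0 : H)) T))
  (hrK : ∀ (i t : Fin T) (a : A), Integrable (fun τ => M.r (τ.1 i.castSucc, τ.2 i) *
    kerSec H (τ.1 t.castSucc, a) (τ.1 t.castSucc, a)) (trajLaw M (policy hK 𝒯 (0 : H)) T))

omit [Nonempty A] [DiscreteMeasurableSpace A] in
include hr in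
theorem integrable_trajReturn :
    Integrable (fun τ => trajReturn M τ) (trajLaw M (policy hK 𝒯 (0 : H)) T) :=
  integrable_finsetSum _ fun i _ => (hr i).const_mul _

include hr hrK in
theorem integrable_weight_smul_return_smul_scoreSum (h : H) :
    Integrable (fun τ => weight 𝒯 h τ • trajReturn M τ • scoreSum 𝒯 h τ)
      (trajLaw M (policy hK 𝒯 (0 : H)) T) := by
  refine Integrable.mono' ((((integrable_absReturn M hr).add
    (integrable_absReturn_mul_trajKerNorm_sq M hK hrK)).const_mul (2 * |𝒯|)).const_mul
      ((Fintype.card A : ℝ) ^ T)) ?_ (Filter.Eventually.of_forall fun τ =>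
        norm_weight_smul_le 𝒯 h τ (norm_return_smul_scoreSum_le M 𝒯 h τ))
  exact ((measurable_weight hK 𝒯 h).stronglyMeasurable.smul
    ((measurable_trajReturn M).stronglyMeasurable.smul
      (stronglyMeasurable_scoreSum hK 𝒯 h))).aestronglyMeasurable

-- Dominated differentiation against the fixed uniform law. The bound holds for every h, so the
-- neighbourhood is all of H.
include hr hrK in
theorem hasGradientAt_expReturn (h : H) :
    HasGradientAt (fun h : H => expReturn M T hK 𝒯 h)
      (∫ τ, weight 𝒯 h τ • trajReturn M τ • scoreSum 𝒯 h τ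
        ∂(trajLaw M (policy hK 𝒯 (0 : H)) T)) h := by
  rw [hasGradientAt_iff_hasFDerivAt]
  have hJ : (fun h : H => expReturn M T hK 𝒯 h) = fun h => ∫ τ, weight 𝒯 h τ • trajReturn M τ
      ∂(trajLaw M (policy hK 𝒯 (0 : H)) T) :=
    funext fun h => integral_trajLaw_eq M hK 𝒯 h T _
  have hint := integrable_weight_smul_return_smul_scoreSum M hK hr hrK
  have hmeas : ∀ h : H, AEStronglyMeasurable
      (fun τ : Traj S A T => weight 𝒯 h τ • trajReturn M τ)
      (trajLaw M (policy hK 𝒯 (0 : H)) T) := fun h =>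
    ((measurable_weight hK 𝒯 h).stronglyMeasurable.smul
      (measurable_trajReturn M).stronglyMeasurable).aestronglyMeasurable
  rw [hJ]
  refine (hasFDerivAt_integral_of_dominated_of_fderiv_le
    (F' := fun h τ => innerSL ℝ (weight 𝒯 h τ • trajReturn M τ • scoreSum 𝒯 h τ))
    (bound := fun τ => (Fintype.card A : ℝ) ^ T *
      (2 * |𝒯| * (absReturn M τ + absReturn M τ * trajKerNorm H τ ^ 2)))
    Filter.univ_mem (Filter.Eventually.of_forall hmeas) ?_ ?_ ?_ ?_ ?_).congr_fderiv ?_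
  · exact ((integrable_absReturn M hr).const_mul ((Fintype.card A : ℝ) ^ T)).mono' (hmeas h)
      (Filter.Eventually.of_forall fun τ =>
        norm_weight_smul_le 𝒯 h τ (abs_trajReturn_le M τ))
  · exact (innerSL ℝ).continuous.comp_aestronglyMeasurable (hint h).1
  · refine Filter.Eventually.of_forall fun τ h _ => ?_
    rw [innerSL_apply_norm]
    exact norm_weight_smul_le 𝒯 h τ (norm_return_smul_scoreSum_le M 𝒯 h τ)
  · exact (((integrable_absReturn M hr).add
      (integrable_absReturn_mul_trajKerNorm_sq M hK hrK)).const_mul _).const_mul _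
  · refine Filter.Eventually.of_forall fun τ h _ => ?_
    refine ((hasFDerivAt_weight 𝒯 h τ).mul_const (trajReturn M τ)).congr_fderiv ?_
    rw [map_smul, map_smul, smul_comm]
  · exact (innerSL ℝ).integral_comp_comm (hint h)

include hrK in
theorem integrable_return_smul_weightHess (h : H) :
    Integrable (fun τ => trajReturn M τ • weightHess 𝒯 h τ) (trajLaw M (policy hK 𝒯 h) T) := by
  refine integrable_trajLaw M hK 𝒯 h (((integrable_absReturn_mul_trajKerNorm_sq M hK
    hrK).const_mul (6 * 𝒯 ^ 2)).mono' ?_ (Filter.Eventually.of_forall fun τ =>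
      norm_return_smul_weightHess_le M 𝒯 h τ))
  exact ((measurable_trajReturn M).stronglyMeasurable.smul
    (stronglyMeasurable_weightHess hK 𝒯 h)).aestronglyMeasurable

include hrK in
theorem integrable_hessIntegrand (h : H) :
    Integrable (fun τ : Traj S A T => hessIntegrand M 𝒯 h τ) (trajLaw M (policy hK 𝒯 h) T) :=
  integrable_trajLaw M hK 𝒯 h (((integrable_absReturn_mul_trajKerNorm_sq M hK
    hrK).const_mul (6 * 𝒯 ^ 2)).mono'
      (stronglyMeasurable_hessIntegrand M hK 𝒯 h).aestronglyMeasurable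
      (Filter.Eventually.of_forall fun τ => norm_hessIntegrand_le M 𝒯 h τ))

include hrK in
theorem integral_return_smul_weightHess (h : H) :
    ∫ τ, trajReturn M τ • weightHess 𝒯 h τ ∂(trajLaw M (policy hK 𝒯 h) T) =
      ∫ τ, hessIntegrand M 𝒯 h τ ∂(trajLaw M (policy hK 𝒯 h) T) := by
  have h1 := integrable_return_smul_weightHess M hK hrK h
  have h2 := integrable_hessIntegrand M hK hrK h
  rw [← sub_eq_zero, ← integral_sub h1 h2]
  exact integral_return_smul_weightHess_sub_hessIntegrand M hK 𝒯 h T (h1.sub h2)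

-- The gradient is again an integral against the uniform law, so the domination argument repeats.
-- Rewards to go enter only in identifying the resulting derivative.
include hr hrK in
theorem hasFDerivAt_gradient_expReturn (h : H) :
    HasFDerivAt (fun h : H => ∇ (fun h' : H => expReturn M T hK 𝒯 h') h)
      (tensorOp (∫ τ, hessIntegrand M 𝒯 h τ ∂(trajLaw M (policy hK 𝒯 h) T))) h := by
  have hJ : (fun h : H => ∇ (fun h' : H => expReturn M T hK 𝒯 h') h) = fun h =>
      ∫ τ, weight 𝒯 h τ • trajReturn M τ • scoreSum 𝒯 h τ
        ∂(trajLaw M (policy hK 𝒯 (0 : H)) T) :=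
    funext fun h => (hasGradientAt_expReturn M hK hr hrK h).gradient
  have hint := integrable_weight_smul_return_smul_scoreSum M hK hr hrK
  have hmeas : StronglyMeasurable fun τ : Traj S A T =>
      weight 𝒯 h τ • trajReturn M τ • weightHess 𝒯 h τ :=
    (measurable_weight hK 𝒯 h).stronglyMeasurable.smul
      ((measurable_trajReturn M).stronglyMeasurable.smul (stronglyMeasurable_weightHess hK 𝒯 h))
  have hbound : Integrable (fun τ : Traj S A T => (Fintype.card A : ℝ) ^ T *
      (6 * 𝒯 ^ 2 * (absReturn M τ * trajKerNorm H τ ^ 2)))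
      (trajLaw M (policy hK 𝒯 (0 : H)) T) :=
    ((integrable_absReturn_mul_trajKerNorm_sq M hK hrK).const_mul _).const_mul _
  have hhess : Integrable (fun τ : Traj S A T =>
      weight 𝒯 h τ • trajReturn M τ • weightHess 𝒯 h τ) (trajLaw M (policy hK 𝒯 (0 : H)) T) :=
    hbound.mono' hmeas.aestronglyMeasurable (Filter.Eventually.of_forall fun τ =>
      norm_weight_smul_le 𝒯 h τ (norm_return_smul_weightHess_le M 𝒯 h τ))
  rw [hJ]
  refine (hasFDerivAt_integral_of_dominated_of_fderiv_le
    (F' := fun h τ => tensorOpL H (weight 𝒯 h τ • trajReturn M τ • weightHess 𝒯 h τ))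
    Filter.univ_mem (Filter.Eventually.of_forall fun h => (hint h).1) (hint h) ?_ ?_ hbound
    ?_).congr_fderiv ?_
  · exact (tensorOpL H).continuous.comp_aestronglyMeasurable hhess.1
  · refine Filter.Eventually.of_forall fun τ h _ => (norm_tensorOp_le _).trans ?_
    exact norm_weight_smul_le 𝒯 h τ (norm_return_smul_weightHess_le M 𝒯 h τ)
  · refine Filter.Eventually.of_forall fun τ h _ => ?_
    have h1 := (hasFDerivAt_weight_smul_scoreSum 𝒯 h τ).fun_const_smul (trajReturn M τ)
    simp_rw [smul_comm (trajReturn M τ)] at h1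
    rw [map_smul, map_smul]
    exact h1
  · rw [← integral_return_smul_weightHess M hK hrK, integral_trajLaw_eq M hK 𝒯 h, ← tensorOpL_apply]
    exact (tensorOpL H).integral_comp_comm hhess

end Derivatives

end PolicyNewton

theorem mainTheorem2 {S A H : Type*} [MeasurableSpace S]
    [Fintype A] [Nonempty A] [MeasurableSpace A] [DiscreteMeasurableSpace A]
    [NormedAddCommGroup H] [InnerProductSpace ℝ H] [CompleteSpace H] [RKHS ℝ H (S × A) ℝ]
    (M : MDP S A) (T : ℕ) (𝒯 : ℝ)
    (hK : ∀ a : A, StronglyMeasurable fun s : S => kerSec H (s, a))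
    (hr : ∀ i : Fin T,
      Integrable (fun τ => M.r (τ.1 i.castSucc, τ.2 i)) (trajLaw M (policy hK 𝒯 (0 : H)) T))
    (hrK : ∀ (i t : Fin T) (a : A),
      Integrable
        (fun τ => M.r (τ.1 i.castSucc, τ.2 i) *
          kerSec H (τ.1 t.castSucc, a) (τ.1 t.castSucc, a))
        (trajLaw M (policy hK 𝒯 (0 : H)) T)) :
    (∀ (s : S) (a : A), Differentiable ℝ fun h : H => Real.log (softmax 𝒯 h s a)) ∧
    (∀ h : H, Integrable
      (fun τ => ∑ t : Fin T, M.γ ^ ((t : ℤ) - 1) * M.r (τ.1 t.castSucc, τ.2 t))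
      (trajLaw M (policy hK 𝒯 h) T)) ∧
    (Differentiable ℝ fun h : H => expReturn M T hK 𝒯 h) ∧
    ∀ h : H,
      Integrable (fun τ : Traj S A T => hessIntegrand M 𝒯 h τ) (trajLaw M (policy hK 𝒯 h) T) ∧
      HasFDerivAt (fun h' : H => ∇ (fun h'' : H => expReturn M T hK 𝒯 h'') h')
        (tensorOp (∫ τ, hessIntegrand M 𝒯 h τ ∂(trajLaw M (policy hK 𝒯 h) T))) h := by
  refine ⟨fun s a h => (hasFDerivAt_log_softmax 𝒯 h s a).differentiableAt,
    fun h => integrable_trajLaw M hK 𝒯 h (integrable_trajReturn M hK hr),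
    fun h => (hasGradientAt_expReturn M hK hr hrK h).differentiableAt,
    fun h => ⟨integrable_hessIntegrand M hK hrK h,
      hasFDerivAt_gradient_expReturn M hK hr hrK h⟩⟩
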